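/- Let $1 \le d < n$ be integers, let $X_1,\dots,X_n$ be independent Rademacher random variables ($\mathbb P\{X_i=1\}=\mathbb P\{X_i=-1\}=1/2$), let $\mathcal I_{n,d}$ be the family of subsets of $\{1,\dots,n\}$ of size $d$, and let $\mathcal T$ be a nonempty compact set of real vectors $\tau=(\tau_I)_{I\in\mathcal I_{n,d}}$. Put $$Z=\sup_{\tau\in\mathcal T}\Big|\sum_{I\in\mathcal I_{n,d}}\Big(\prod_{i\in I}X_i\Big)\tau_I\Big|$$ and, for $1\le k\le d$, $$W_k=\sup_{\tau\in\mathcal T}\ \sup_{\substack{\alpha^{(1)},\dots,\alpha^{(k)}\in\mathbb R^n\\ \|\alpha^{(h)}\|_2\le 1,\ h\le k}}\Big|\sum_{J\in\mathcal I_{n,d-k}}\Big(\prod_{j\in J}X_j\Big)\sum_{\substack{i_1,\dots,i_k\in\{1,\dots,n\}\\ \{i_1,\dots,i_k\}\cup J\in\mathcal I_{n,d}}}\Big(\prod_{h=1}^k\alpha^{(h)}_{i_h}\Big)\tau_{\{i_1,\dots,i_k\}\cup J}\Big|.$$ Let $\kappa=\frac{\sqrt e}{2(\sqrt e-1)}$.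 Then $Z$ and $W_1,\dots,W_d$ are integrable and, for all $t\ge 0$, $$\mathbb P\{Z\ge\mathbb E[Z]+t\}\le 2\exp\left(-\frac{\log 2}{4\kappa}\min_{1\le j\le d}\left(\frac{t}{2d\,\mathbb E[W_j]}\right)^{2/j}\right),$$ where, if some $\mathbb E[W_j]$ is $0$, the right-hand side is read as $0$ for $t>0$ and as $2$ for $t=0$. -/

import Mathlib

open MeasureTheory ProbabilityTheory
open scoped ENNReal

noncomputable section

namespace RademacherChaos

/-- The constant `κ = √e / (2 (√e - 1))`. -/
def kappa : ℝ := √(Real.exp 1) / (2 * (√(Real.exp 1) - 1))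

/-- The Rademacher law on `ℝ`: mass `1/2` at each of `1` and `-1`. -/
def rademacherLaw : Measure ℝ :=
  (2⁻¹ : ℝ≥0∞) • Measure.dirac 1 + (2⁻¹ : ℝ≥0∞) • Measure.dirac (-1)

/-- The family of the subsets of size `d` of an `n`-element set, as an index type. -/
abbrev Subsets (n d : ℕ) : Type := {I : Finset (Fin n) // I.card = d}

/-- The homogeneous chaos `∑_I (∏_{i ∈ I} x_i) τ_I` of order `d`, where `I` runs over the subsets
of size `d`, evaluated at `x`. -/
def chaos {n d : ℕ} (τ : Subsets n d → ℝ) (x : Fin n → ℝ) : ℝ :=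
  ∑ I : Subsets n d, (∏ i ∈ I.1, x i) * τ I

/-- `sup_{τ ∈ T} |chaos τ x|`. -/
def supChaos {n d : ℕ} (T : Set (Subsets n d → ℝ)) (x : Fin n → ℝ) : ℝ :=
  sSup ((fun τ => |chaos τ x|) '' T)

/-- The sum over all `k`-tuples `(i_1, …, i_k)` with `{i_1, …, i_k} ∪ J` of size `d` of the terms
`(∏_h α^{(h)}_{i_h}) τ_{{i_1, …, i_k} ∪ J}`. -/
def contraction {n d k : ℕ} (τ : Subsets n d → ℝ) (α : Fin k → EuclideanSpace ℝ (Fin n))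
    (J : Finset (Fin n)) : ℝ :=
  ∑ i : Fin k → Fin n,
    if hi : (Finset.univ.image i ∪ J).card = d then
      (∏ h, α h (i h)) * τ ⟨Finset.univ.image i ∪ J, hi⟩
    else 0

/-- The quantity `W_k` at `x`, for `k ≤ d`: the supremum, over `τ ∈ T` and over `k`-tuples of
vectors of the closed Euclidean unit ball, of the absolute value of the sum over the subsets `J`
of size `d - k` of `(∏_{j ∈ J} x_j)` times the contraction of `τ`. -/
def supContraction {n d : ℕ} (T : Set (Subsets n d → ℝ)) (k : ℕ) (x : Fin n → ℝ) : ℝ :=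
  sSup (Set.image2
    (fun (τ : Subsets n d → ℝ) (α : Fin k → EuclideanSpace ℝ (Fin n)) =>
      |∑ J : Subsets n (d - k), (∏ j ∈ J.1, x j) * contraction τ α J.1|)
    T {α | ∀ h, ‖α h‖ ≤ 1})

end RademacherChaos

end

namespace RademacherChaos

open scoped BigOperators

/-! Put `W 0 = Z`. The chaos contracted by `k` vectors is affine in each sign, so flipping the
`i`-th sign changes it by twice its `i`-th partial derivative up to sign, and by duality the
Euclidean norm of its gradient comes from contracting with one further vector. Testing with a
maximizer at `x` bounds the one-sided variation of `W k` by `2 * W (k + 1) ^ 2`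
(`upVariation_supContraction_le`), and `W d` is not random.

One-sided control of the variation yields moments. For `1 ≤ p ≤ 2` the entropy `E f^p - (E f)^p` is
subadditive over the coordinates (`expect_rpow_sub_rpow_expect_le`). Applied to the power `q - 1` of
`g = (f - E f)_+` with `p = q / (q - 1)`, it bounds `E g^q` by `E g^(q-1)` and the variation
(`expect_posPart_rpow_le`); `kappa` is the constant for which induction on `q` closes.

Hence, with `Q = max q 2`, the `L^Q` norm of `(W k - E W k)_+` is at most `√(4κq)` times a bound for
that of `W (k + 1)`. Unrolling down from `d` bounds the norm of `(Z - E Z)_+` by `∑_{1 ≤ j ≤ d}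
(4κq)^(j/2) E W_j`. Markov's inequality, with `q` chosen to make this at most `t / 2`, gives the
tail. -/

/-! ### Two-point power entropies -/

/-- The entropy of the power function `x ↦ x ^ p` under the uniform law on two points. -/
noncomputable def powerEntropy (p a b : ℝ) : ℝ := (a ^ p + b ^ p) / 2 - ((a + b) / 2) ^ p

/-- Concavity of `x ↦ x ^ (2 - p)` reduces this to the Cauchy-Schwarz inequality `(α + β)² / (A + B)
≤ α² / A + β² / B`. It is the convexity of `powerEntropy p` along segments, up to the factor `p * (p
- 1)`. -/
lemma powerEntropy_second_derivative_nonneg {p u v : ℝ} (α β : ℝ) (hp : 1 ≤ p) (hp2 : p ≤ 2)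
    (hu : 0 < u) (hv : 0 < v) :
    ((α + β) / 2) ^ 2 * ((u + v) / 2) ^ (p - 2) ≤
      (α ^ 2 * u ^ (p - 2) + β ^ 2 * v ^ (p - 2)) / 2 := by
  have key : ∀ x : ℝ, 0 < x → x ^ (p - 2) = (x ^ (2 - p))⁻¹ := fun x hx => by
    rw [← Real.rpow_neg hx.le]; congr 1; ring
  rw [key _ hu, key _ hv, key _ (by positivity)]
  have hc := (Real.concaveOn_rpow (p := 2 - p) (by linarith) (by linarith)).2
    (Set.mem_Ici.2 hu.le) (Set.mem_Ici.2 hv.le) (by norm_num : (0 : ℝ) ≤ 1 / 2)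
    (by norm_num : (0 : ℝ) ≤ 1 / 2) (by norm_num)
  simp only [smul_eq_mul] at hc
  rw [show 1 / 2 * u + 1 / 2 * v = (u + v) / 2 by ring] at hc
  have hA : 0 < u ^ (2 - p) := by positivity
  have hB : 0 < v ^ (2 - p) := by positivity
  have hM : 0 < ((u + v) / 2) ^ (2 - p) := by positivity
  generalize u ^ (2 - p) = A at *
  generalize v ^ (2 - p) = B at *
  generalize ((u + v) / 2) ^ (2 - p) = M at *
  calc ((α + β) / 2) ^ 2 * M⁻¹ ≤ ((α + β) / 2) ^ 2 * ((A + B) / 2)⁻¹ := by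
        gcongr; linarith
    _ ≤ (α ^ 2 * A⁻¹ + β ^ 2 * B⁻¹) / 2 := by
        rw [← sub_nonneg]
        have : (α ^ 2 * A⁻¹ + β ^ 2 * B⁻¹) / 2 - ((α + β) / 2) ^ 2 * ((A + B) / 2)⁻¹
            = (α * B - β * A) ^ 2 / (2 * A * B * (A + B)) := by field_simp; ring
        rw [this]; positivity

/-- Joint convexity, checked by differentiating twice along the segment from `(a, b)` to `(a', b')`.
-/
lemma powerEntropy_midpoint_le {p a b a' b' : ℝ} (hp : 1 ≤ p) (hp2 : p ≤ 2)
    (ha : 0 < a) (hb : 0 < b) (ha' : 0 < a') (hb' : 0 < b') :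
    powerEntropy p ((a + a') / 2) ((b + b') / 2) ≤
      (powerEntropy p a b + powerEntropy p a' b') / 2 := by
  set u : ℝ → ℝ := fun s => a + s * (a' - a) with hu
  set v : ℝ → ℝ := fun s => b + s * (b' - b) with hv
  have upos : ∀ s ∈ Set.Icc (0 : ℝ) 1, 0 < u s := fun s hs => by
    have : u s = (1 - s) * a + s * a' := by simp only [hu]; ring
    rcases hs.1.eq_or_lt with h | h
    · rw [this, ← h]; simpa
    · rw [this]; have := mul_pos h ha'; have := mul_nonneg (sub_nonneg.2 hs.2) ha.le; linarith
  have vpos : ∀ s ∈ Set.Icc (0 : ℝ) 1, 0 < v s := fun s hs => by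
    have : v s = (1 - s) * b + s * b' := by simp only [hv]; ring
    rcases hs.1.eq_or_lt with h | h
    · rw [this, ← h]; simpa
    · rw [this]; have := mul_pos h hb'; have := mul_nonneg (sub_nonneg.2 hs.2) hb.le; linarith
  have du : ∀ s, HasDerivAt u (a' - a) s := fun s =>
    (((hasDerivAt_id s).mul_const (a' - a)).const_add a).congr_deriv (one_mul _)
  have dv : ∀ s, HasDerivAt v (b' - b) s := fun s =>
    (((hasDerivAt_id s).mul_const (b' - b)).const_add b).congr_deriv (one_mul _)
  have dm : ∀ s, HasDerivAt (fun s => (u s + v s) / 2) (((a' - a) + (b' - b)) / 2) s :=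
    fun s => ((du s).add (dv s)).div_const 2
  have hconv : ConvexOn ℝ (Set.Icc (0 : ℝ) 1) (fun s => powerEntropy p (u s) (v s)) := by
    have d1 : ∀ s ∈ Set.Icc (0 : ℝ) 1, HasDerivAt (fun s => powerEntropy p (u s) (v s))
        (((a' - a) * p * u s ^ (p - 1) + (b' - b) * p * v s ^ (p - 1)) / 2
          - ((a' - a) + (b' - b)) / 2 * p * ((u s + v s) / 2) ^ (p - 1)) s := fun s hs =>
      ((((du s).rpow_const (Or.inl (upos s hs).ne')).add
        ((dv s).rpow_const (Or.inl (vpos s hs).ne'))).div_const 2).sub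
        ((dm s).rpow_const (Or.inl (by have := upos s hs; have := vpos s hs; positivity)))
    refine convexOn_of_hasDerivWithinAt2_nonneg (convex_Icc 0 1)
      (fun s hs => (d1 s hs).continuousAt.continuousWithinAt)
      (fun s hs => (d1 s (interior_subset hs)).hasDerivWithinAt)
      (f'' := fun s => ((a' - a) * p * ((a' - a) * (p - 1) * u s ^ (p - 1 - 1))
          + (b' - b) * p * ((b' - b) * (p - 1) * v s ^ (p - 1 - 1))) / 2
          - ((a' - a) + (b' - b)) / 2 * p * (((a' - a) + (b' - b)) / 2 * (p - 1)
            * ((u s + v s) / 2) ^ (p - 1 - 1))) (fun s hs => ?_) (fun s hs => ?_)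
    · have hs := interior_subset hs
      exact ((((((du s).rpow_const (Or.inl (upos s hs).ne')).const_mul ((a' - a) * p))).add
        ((((dv s).rpow_const (Or.inl (vpos s hs).ne'))).const_mul ((b' - b) * p))).div_const 2).sub
        ((((dm s).rpow_const (Or.inl (by have := upos s hs; have := vpos s hs; positivity)))).const_mul
          (((a' - a) + (b' - b)) / 2 * p)) |>.hasDerivWithinAt
    · have hs := interior_subset hs
      have := mul_le_mul_of_nonneg_left (powerEntropy_second_derivative_nonneg (a' - a) (b' - b)
        hp hp2 (upos s hs) (vpos s hs)) (mul_nonneg (by linarith : 0 ≤ p) (sub_nonneg.2 hp))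
      rw [show p - 1 - 1 = p - 2 by ring]
      linarith
  have h := hconv.2 (Set.left_mem_Icc.2 zero_le_one) (Set.right_mem_Icc.2 zero_le_one)
    (by norm_num : (0 : ℝ) ≤ 1 / 2) (by norm_num : (0 : ℝ) ≤ 1 / 2) (by norm_num)
  simp only [hu, hv, smul_eq_mul] at h
  ring_nf at h ⊢
  exact h

/-- The tangent line inequality for `x ↦ x ^ p` in terms of the conjugate exponent `q`. -/
lemma conjugate_tangent_le {p q s m : ℝ} (hpq : p.HolderConjugate q) (hs : 0 ≤ s) (hm : 0 ≤ m) :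
    p * (s * m) - (p - 1) * s ^ q ≤ m ^ p := by
  have h := Real.young_inequality_of_nonneg hm hs hpq
  have hp := hpq.pos
  have hq := hpq.symm.pos
  have e : p / q = p - 1 := by
    have := hpq.inv_add_inv_eq_one; field_simp at this ⊢; linarith
  have := mul_le_mul_of_nonneg_left h hp.le
  rw [mul_add, mul_div_cancel₀ _ hp.ne', ← mul_div_assoc, mul_comm p (s ^ q), mul_div_assoc, e]
    at this
  linarith

/-- Averaging the tangent bounds at `s` and `t` gives `p / 4 * (s - t) * (s ^ (q - 1) - t ^ (q -
1))`; the last factor is at most `(q - 1) * s ^ (q - 2) * (s - t)`, and `p * (q - 1) = q`. -/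
lemma powerEntropy_rpow_le {p q s t : ℝ} (hpq : p.HolderConjugate q) (hq : 2 ≤ q)
    (ht : 0 ≤ t) (hts : t ≤ s) :
    powerEntropy p (s ^ (q - 1)) (t ^ (q - 1)) ≤ q / 4 * (s ^ (q - 2) * (s - t) ^ 2) := by
  have hs := ht.trans hts
  have hqp : (q - 1) * p = q := hpq.symm.sub_one_mul_conj
  have hpow : ∀ x : ℝ, 0 ≤ x → (x ^ (q - 1)) ^ p = x ^ q := fun x hx => by
    rw [← Real.rpow_mul hx, hqp]
  have hmul : ∀ x : ℝ, 0 ≤ x → x * x ^ (q - 1) = x ^ q := fun x hx => by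
    rw [← Real.rpow_one_add' hx (by linarith)]; congr 1; ring
  have hm : 0 ≤ (s ^ (q - 1) + t ^ (q - 1)) / 2 := by positivity
  have h1 := conjugate_tangent_le hpq hs hm
  have h2 := conjugate_tangent_le hpq ht hm
  -- Bernoulli's inequality at the ratio `t / s`.
  have hb : s ^ (q - 1) - t ^ (q - 1) ≤ (q - 1) * (s ^ (q - 2) * (s - t)) := by
    rcases hs.eq_or_lt with rfl | hs0
    · have : t = 0 := le_antisymm hts ht
      simp [this]
    have := one_add_mul_self_le_rpow_one_add (s := t / s - 1) (p := q - 1)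
      (by linarith [div_nonneg ht hs]) (by linarith)
    rw [add_sub_cancel, Real.div_rpow ht hs, le_div_iff₀ (by positivity)] at this
    have e : s ^ (q - 1) = s ^ (q - 2) * s := by
      rw [← Real.rpow_add_one hs0.ne']; congr 1; ring
    rw [e] at this ⊢
    have e2 : (1 + (q - 1) * (t / s - 1)) * (s ^ (q - 2) * s)
      = s ^ (q - 2) * s + (q - 1) * (s ^ (q - 2) * (t - s)) := by field_simp
    rw [e2] at this
    linarith
  have h3 : p * ((s - t) * (s ^ (q - 1) - t ^ (q - 1))) ≤
      p * ((s - t) * ((q - 1) * (s ^ (q - 2) * (s - t)))) :=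
    mul_le_mul_of_nonneg_left (mul_le_mul_of_nonneg_left hb (sub_nonneg.2 hts)) hpq.pos.le
  have h4 : p * ((s - t) * ((q - 1) * (s ^ (q - 2) * (s - t)))) =
      q * (s ^ (q - 2) * (s - t) ^ 2) := by
    linear_combination (s ^ (q - 2) * (s - t) ^ 2) * hqp
  have h5 := hmul s hs
  have h6 := hmul t ht
  unfold powerEntropy
  rw [hpow s hs, hpow t ht]
  nlinarith

/-! ### Averaging on the cube and tensorization of the entropy -/

/-- The sign change of the `i`-th coordinate of a point of the cube. -/
def flip {n : ℕ} (i : Fin n) (x : Fin n → ℤˣ) : Fin n → ℤˣ := x * Pi.mulSingle i (-1)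

lemma flip_flip {n : ℕ} (i : Fin n) (x : Fin n → ℤˣ) : flip i (flip i x) = x := by
  simp [flip, mul_assoc, ← Pi.mulSingle_mul]

lemma flip_comm {n : ℕ} (i j : Fin n) (x : Fin n → ℤˣ) :
    flip i (flip j x) = flip j (flip i x) := by
  simp only [flip]; exact mul_right_comm _ _ _

lemma expect_flip {n : ℕ} (i : Fin n) (f : (Fin n → ℤˣ) → ℝ) :
    𝔼 x, f (flip i x) = 𝔼 x, f x :=
  Fintype.expect_equiv (Equiv.mulRight (Pi.mulSingle i (-1))) _ _ fun _ => rfl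

/-- The average over the `i`-th coordinate. -/
noncomputable def coordMean {n : ℕ} (i : Fin n) (f : (Fin n → ℤˣ) → ℝ) (x : Fin n → ℤˣ) : ℝ :=
  (f x + f (flip i x)) / 2

lemma expect_coordMean {n : ℕ} (i : Fin n) (f : (Fin n → ℤˣ) → ℝ) :
    𝔼 x, coordMean i f x = 𝔼 x, f x := by
  simp only [coordMean]
  rw [← Finset.expect_div, Finset.expect_add_distrib, expect_flip, add_self_div_two]

lemma coordMean_flip {n : ℕ} (i : Fin n) (f : (Fin n → ℤˣ) → ℝ) (x : Fin n → ℤˣ) :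
    coordMean i f (flip i x) = coordMean i f x := by
  rw [coordMean, coordMean, flip_flip, add_comm]

lemma coordMean_flip_of_invariant {n : ℕ} (i j : Fin n) {f : (Fin n → ℤˣ) → ℝ}
    (hf : ∀ x, f (flip j x) = f x) (x : Fin n → ℤˣ) :
    coordMean i f (flip j x) = coordMean i f x := by
  rw [coordMean, coordMean, hf, flip_comm, hf]

/-- The successive averages over the coordinates in a list. -/
noncomputable def listMean {n : ℕ} (l : List (Fin n)) (f : (Fin n → ℤˣ) → ℝ) : (Fin n → ℤˣ) → ℝ :=
  l.foldl (fun g i => coordMean i g) f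

lemma expect_listMean {n : ℕ} (l : List (Fin n)) (f : (Fin n → ℤˣ) → ℝ) :
    𝔼 x, listMean l f x = 𝔼 x, f x := by
  induction l generalizing f with
  | nil => rfl
  | cons i l ih => exact (ih (coordMean i f)).trans (expect_coordMean i f)

lemma listMean_flip_of_invariant {n : ℕ} (l : List (Fin n)) (j : Fin n)
    {f : (Fin n → ℤˣ) → ℝ} (hf : ∀ x, f (flip j x) = f x) (x : Fin n → ℤˣ) :
    listMean l f (flip j x) = listMean l f x := by
  induction l generalizing f with
  | nil => exact hf x
  | cons i l ih => exact ih (coordMean_flip_of_invariant i j hf)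

lemma listMean_flip {n : ℕ} {l : List (Fin n)} {j : Fin n} (hj : j ∈ l)
    (f : (Fin n → ℤˣ) → ℝ) (x : Fin n → ℤˣ) :
    listMean l f (flip j x) = listMean l f x := by
  induction l generalizing f with
  | nil => simp at hj
  | cons i l ih =>
    rcases List.mem_cons.1 hj with rfl | hj
    · exact listMean_flip_of_invariant l j (coordMean_flip j f) x
    · exact ih hj _

lemma eq_of_flip_invariant {n : ℕ} {f : (Fin n → ℤˣ) → ℝ}
    (hf : ∀ i x, f (flip i x) = f x) (x : Fin n → ℤˣ) : f x = f 1 := by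
  have key : ∀ s : Finset (Fin n), f (∏ i ∈ s, Pi.mulSingle i (x i)) = f 1 := by
    intro s
    induction s using Finset.induction_on with
    | empty => simp
    | insert i s hi ih =>
      rw [Finset.prod_insert hi, mul_comm, ← ih]
      rcases Int.units_eq_one_or (x i) with h | h
      · simp [h]
      · rw [h]; exact hf i _
  rw [← key Finset.univ, Finset.univ_prod_mulSingle]

lemma listMean_finRange {n : ℕ} (f : (Fin n → ℤˣ) → ℝ) (x : Fin n → ℤˣ) :
    listMean (List.finRange n) f x = 𝔼 y, f y := by
  have h : ∀ y, listMean (List.finRange n) f y = listMean (List.finRange n) f 1 :=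
    eq_of_flip_invariant fun i y => listMean_flip (List.mem_finRange i) f y
  rw [← expect_listMean (List.finRange n) f, h x]
  simp only [h, Fintype.expect_const]

lemma coordMean_pos {n : ℕ} (i : Fin n) {f : (Fin n → ℤˣ) → ℝ} (hf : ∀ x, 0 < f x)
    (x : Fin n → ℤˣ) : 0 < coordMean i f x := by
  have := hf x; have := hf (flip i x); simp only [coordMean]; positivity

lemma expect_powerEntropy_coordMean_le {n : ℕ} {p : ℝ} (hp : 1 ≤ p) (hp2 : p ≤ 2) (i j : Fin n)
    {f : (Fin n → ℤˣ) → ℝ} (hf : ∀ x, 0 < f x) :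
    𝔼 x, powerEntropy p (coordMean i f x) (coordMean i f (flip j x)) ≤
      𝔼 x, powerEntropy p (f x) (f (flip j x)) := by
  rw [← expect_coordMean i (fun x => powerEntropy p (f x) (f (flip j x)))]
  refine Finset.expect_le_expect fun x _ => ?_
  rw [coordMean, coordMean, coordMean, flip_comm i j x]
  exact powerEntropy_midpoint_le hp hp2 (hf _) (hf _) (hf _) (hf _)

/-- Coordinates are averaged out one at a time; by convexity, each averaging can only lower the
entropies in the remaining coordinates. -/
lemma expect_rpow_sub_listMean_le {n : ℕ} {p : ℝ} (hp : 1 ≤ p) (hp2 : p ≤ 2)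
    (l : List (Fin n)) {f : (Fin n → ℤˣ) → ℝ} (hf : ∀ x, 0 < f x) :
    𝔼 x, f x ^ p - 𝔼 x, listMean l f x ^ p ≤
      (l.map fun i => 𝔼 x, powerEntropy p (f x) (f (flip i x))).sum := by
  induction l generalizing f with
  | nil => simp [listMean]
  | cons i l ih =>
    have h1 := ih (coordMean_pos i hf)
    have h2 : (l.map fun j => 𝔼 x, powerEntropy p (coordMean i f x)
        (coordMean i f (flip j x))).sum ≤
        (l.map fun j => 𝔼 x, powerEntropy p (f x) (f (flip j x))).sum :=
      List.sum_le_sum fun j _ => expect_powerEntropy_coordMean_le hp hp2 i j hf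
    -- Averaging one coordinate costs exactly the two-point entropy in that coordinate.
    have h3 : 𝔼 x, powerEntropy p (f x) (f (flip i x)) =
        𝔼 x, f x ^ p - 𝔼 x, coordMean i f x ^ p := by
      rw [← expect_coordMean i (fun x => f x ^ p), ← Finset.expect_sub_distrib]
      rfl
    rw [List.map_cons, List.sum_cons, h3]
    change 𝔼 x, f x ^ p - 𝔼 x, listMean l (coordMean i f) x ^ p ≤ _
    linarith

/-- Subadditivity of the entropy of the power function on the cube. -/
lemma expect_rpow_sub_rpow_expect_le {n : ℕ} {p : ℝ} (hp : 1 ≤ p) (hp2 : p ≤ 2)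
    {f : (Fin n → ℤˣ) → ℝ} (hf : ∀ x, 0 ≤ f x) :
    𝔼 x, f x ^ p - (𝔼 x, f x) ^ p ≤ ∑ i, 𝔼 x, powerEntropy p (f x) (f (flip i x)) := by
  -- Convexity was proved for positive values only, so `f` is shifted by `ε`, which then tends to
  -- `0`.
  have hpos : ∀ ε : ℝ, 0 < ε → 𝔼 x, (f x + ε) ^ p - (𝔼 x, (f x + ε)) ^ p ≤
      ∑ i, 𝔼 x, powerEntropy p (f x + ε) (f (flip i x) + ε) := fun ε hε => by
    have := expect_rpow_sub_listMean_le hp hp2 (List.finRange n) (f := fun x => f x + ε)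
      (fun x => by have := hf x; positivity)
    simp only [listMean_finRange, Fintype.expect_const] at this
    rwa [← List.ofFn_eq_map, List.sum_ofFn] at this
  have hc : ∀ g : ℝ → ℝ, Continuous g → Continuous fun ε => g ε ^ p := fun g hg =>
    hg.rpow_const fun _ => Or.inr (by linarith)
  have hE : ∀ g : ℝ → (Fin n → ℤˣ) → ℝ, (∀ x, Continuous fun ε => g ε x) →
      Continuous fun ε => 𝔼 x, g ε x := fun g hg => by
    simp only [Fintype.expect_eq_sum_div_card]
    exact (continuous_finsetSum _ fun x _ => hg x).div_const _
  have h1 : Continuous fun ε : ℝ => 𝔼 x, (f x + ε) ^ p - (𝔼 x, (f x + ε)) ^ p :=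
    (hE _ fun x => hc _ (by fun_prop)).sub (hc _ (hE _ fun x => by fun_prop))
  have h2 : Continuous fun ε : ℝ => ∑ i, 𝔼 x, powerEntropy p (f x + ε) (f (flip i x) + ε) :=
    continuous_finsetSum _ fun i _ => hE _ fun x =>
      (((hc _ (by fun_prop)).add (hc _ (by fun_prop))).div_const 2).sub (hc _ (by fun_prop))
  have := le_of_tendsto_of_tendsto (h1.continuousWithinAt (s := Set.Ioi 0) (x := 0)).tendsto
    (h2.continuousWithinAt (s := Set.Ioi 0) (x := 0)).tendsto
    (Filter.eventually_of_mem self_mem_nhdsWithin hpos)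
  simpa using this

/-! ### One-sided variation and the moment recursion -/

/-- The sum of the squared positive parts of the increments of `f` under sign changes, halved. -/
noncomputable def upVariation {n : ℕ} (f : (Fin n → ℤˣ) → ℝ) (x : Fin n → ℤˣ) : ℝ :=
  (∑ i, max (f x - f (flip i x)) 0 ^ 2) / 2

lemma upVariation_nonneg {n : ℕ} (f : (Fin n → ℤˣ) → ℝ) (x : Fin n → ℤˣ) :
    0 ≤ upVariation f x := by
  unfold upVariation; positivity

/-- The two terms of the hypothesis are exchanged by the flip, so they have equal means; this is how
a one-sided variation suffices. -/
lemma sum_expect_powerEntropy_le {n : ℕ} {p c : ℝ} {f h w : (Fin n → ℤˣ) → ℝ}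
    (H : ∀ i x, powerEntropy p (h x) (h (flip i x)) ≤
      c / 4 * (w x * max (f x - f (flip i x)) 0 ^ 2 +
        w (flip i x) * max (f (flip i x) - f x) 0 ^ 2)) :
    ∑ i, 𝔼 x, powerEntropy p (h x) (h (flip i x)) ≤ c * 𝔼 x, upVariation f x * w x := by
  have h1 : ∀ i, 𝔼 x, powerEntropy p (h x) (h (flip i x)) ≤
      c / 2 * 𝔼 x, w x * max (f x - f (flip i x)) 0 ^ 2 := fun i => by
    refine (Finset.expect_le_expect fun x _ => H i x).trans_eq ?_
    have := expect_flip i fun x => w x * max (f x - f (flip i x)) 0 ^ 2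
    simp only [flip_flip] at this
    rw [← Finset.mul_expect, Finset.expect_add_distrib, this]
    ring
  refine (Finset.sum_le_sum fun i _ => h1 i).trans_eq ?_
  rw [← Finset.mul_sum, ← Finset.expect_sum_comm, Finset.mul_expect, Finset.mul_expect]
  refine Finset.expect_congr rfl fun x _ => ?_
  rw [upVariation, ← Finset.mul_sum]
  ring

/-- The one-sided Efron-Stein inequality on the cube. -/
lemma expect_sq_sub_sq_expect_le {n : ℕ} {f : (Fin n → ℤˣ) → ℝ} (hf : ∀ x, 0 ≤ f x) :
    𝔼 x, f x ^ 2 - (𝔼 x, f x) ^ 2 ≤ 𝔼 x, upVariation f x := by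
  have h1 := expect_rpow_sub_rpow_expect_le one_le_two le_rfl hf
  have h2 := sum_expect_powerEntropy_le (p := 2) (c := 1) (f := f) (h := f) (w := 1) (fun i x => by
    simp only [powerEntropy, Real.rpow_two, Pi.one_apply, one_mul]
    rcases le_total (f x) (f (flip i x)) with h | h
    · rw [max_eq_right (sub_nonpos.2 h), max_eq_left (sub_nonneg.2 h)]; nlinarith
    · rw [max_eq_left (sub_nonneg.2 h), max_eq_right (sub_nonpos.2 h)]; nlinarith)
  simp only [Real.rpow_two, Pi.one_apply, mul_one, one_mul] at h1 h2
  exact h1.trans h2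

lemma powerEntropy_comm (p a b : ℝ) : powerEntropy p a b = powerEntropy p b a := by
  simp only [powerEntropy, add_comm]

/-- Subadditivity of the entropy is applied to `g ^ (q - 1)`, where `g` is the positive part: its
`p`-th power is `g ^ q`, and `q ≥ 2` is what makes `p ≤ 2`. Truncation at `m` does not increase
upward increments. -/
lemma expect_posPart_rpow_le {n : ℕ} {q : ℝ} (hq : 2 ≤ q) (f : (Fin n → ℤˣ) → ℝ) (m : ℝ) :
    𝔼 x, max (f x - m) 0 ^ q ≤ (𝔼 x, max (f x - m) 0 ^ (q - 1)) ^ (q / (q - 1)) +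
      q * 𝔼 x, upVariation f x * max (f x - m) 0 ^ (q - 2) := by
  set p : ℝ := q / (q - 1) with hp
  have hpq : p.HolderConjugate q := (Real.HolderConjugate.conjExponent (by linarith)).symm
  have hp2 : p ≤ 2 := by rw [hp, div_le_iff₀ (by linarith)]; linarith
  set g : (Fin n → ℤˣ) → ℝ := fun x => max (f x - m) 0 with hg
  have g0 : ∀ x, 0 ≤ g x := fun x => le_max_right _ _
  have hsub : ∀ x y, g x ≤ g y → g y - g x ≤ max (f y - f x) 0 := fun x y h => by
    simp only [hg]
    rcases le_total (f y - m) 0 with h1 | h1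
    · rw [max_eq_right h1]
      linarith [le_max_right (f x - m) 0, le_max_right (f y - f x) 0]
    · rw [max_eq_left h1]
      linarith [le_max_left (f x - m) 0, le_max_left (f y - f x) 0]
  have key : ∀ x y, g x ≤ g y → powerEntropy p (g y ^ (q - 1)) (g x ^ (q - 1)) ≤
      q / 4 * (g y ^ (q - 2) * max (f y - f x) 0 ^ 2) := fun x y h => by
    refine (powerEntropy_rpow_le hpq hq (g0 x) h).trans ?_
    have h1 := hsub x y h
    have h2 := sub_nonneg.2 h
    have h3 : 0 ≤ g y ^ (q - 2) := Real.rpow_nonneg (g0 y) _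
    gcongr
  have h1 := expect_rpow_sub_rpow_expect_le hpq.lt.le hp2 (f := fun x => g x ^ (q - 1))
    (fun x => Real.rpow_nonneg (g0 x) _)
  have h2 := sum_expect_powerEntropy_le (p := p) (c := q) (f := f) (h := fun x => g x ^ (q - 1))
    (w := fun x => g x ^ (q - 2)) (fun i x => by
      have hw := fun y => Real.rpow_nonneg (g0 y) (q - 2)
      rcases le_total (g x) (g (flip i x)) with h | h
      · rw [powerEntropy_comm]
        refine (key _ _ h).trans ?_
        have := mul_nonneg (hw x) (sq_nonneg (max (f x - f (flip i x)) 0))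
        gcongr
        linarith
      · refine (key _ _ h).trans ?_
        have := mul_nonneg (hw (flip i x)) (sq_nonneg (max (f (flip i x) - f x) 0))
        gcongr
        linarith)
  have h3 : ∀ x, (g x ^ (q - 1)) ^ p = g x ^ q := fun x => by
    rw [← Real.rpow_mul (g0 x), hpq.symm.sub_one_mul_conj]
  simp only [h3] at h1
  linarith

lemma expect_rpow_le_of_le {ι : Type*} [Fintype ι] [Nonempty ι] {a b c : ℝ}
    (ha : 0 < a) (hab : a ≤ b) (hc : 0 ≤ c) {f : ι → ℝ} (hf : ∀ x, 0 ≤ f x) (h : 𝔼 x, f x ^ b ≤ c ^ b) : 𝔼 x, f x ^ a ≤ c ^ a := by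
  have hb := ha.trans_le hab
  have h1 := Real.compact_inner_le_weight_mul_Lp_of_nonneg Finset.univ (p := b / a)
    ((one_le_div ha).2 hab) (w := fun _ : ι => 1) (f := fun x => f x ^ a) (fun _ => zero_le_one)
    (fun x => Real.rpow_nonneg (hf x) a)
  simp only [one_mul, Fintype.expect_const, Real.one_rpow] at h1
  refine h1.trans ?_
  have h2 : ∀ x, (f x ^ a) ^ (b / a) = f x ^ b := fun x => by
    rw [← Real.rpow_mul (hf x), mul_div_cancel₀ _ ha.ne']
  simp only [h2]
  calc (𝔼 x, f x ^ b) ^ (b / a)⁻¹ ≤ (c ^ b) ^ (b / a)⁻¹ :=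
        Real.rpow_le_rpow (Finset.expect_nonneg fun x _ => Real.rpow_nonneg (hf x) b) h
          (by positivity)
    _ = c ^ a := by rw [← Real.rpow_mul hc, inv_div, mul_div_cancel₀ _ hb.ne']

lemma expect_mul_rpow_le {ι : Type*} [Fintype ι] {q c : ℝ} (hq : 2 < q) (hc : 0 ≤ c)
    {V g : ι → ℝ} (hV : ∀ x, 0 ≤ V x) (hg : ∀ x, 0 ≤ g x) (h : 𝔼 x, V x ^ (q / 2) ≤ c ^ (q / 2)) :
    𝔼 x, V x * g x ^ (q - 2) ≤ c * (𝔼 x, g x ^ q) ^ (1 - 2 / q) := by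
  -- Hölder's inequality with weight `g ^ q` and exponent `q / 2`. Where `g` vanishes the quotient
  -- is `0` by convention, which is harmless because the weight vanishes too.
  have h1 := Real.compact_inner_le_weight_mul_Lp_of_nonneg Finset.univ (p := q / 2)
    (by linarith) (w := fun x => g x ^ q) (f := fun x => V x / g x ^ (2 : ℝ))
    (fun x => Real.rpow_nonneg (hg x) q)
    (fun x => div_nonneg (hV x) (Real.rpow_nonneg (hg x) _))
  have h2 : ∀ x, g x ^ q * (V x / g x ^ (2 : ℝ)) = V x * g x ^ (q - 2) := fun x => by
    rcases (hg x).eq_or_lt with h0 | h0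
    · rw [← h0, Real.zero_rpow (x := q) (by linarith), Real.zero_rpow (x := q - 2) (by linarith)]
      simp
    · rw [Real.rpow_sub h0]; ring
  have h3 : ∀ x, g x ^ q * (V x / g x ^ (2 : ℝ)) ^ (q / 2) ≤ V x ^ (q / 2) := fun x => by
    rcases (hg x).eq_or_lt with h0 | h0
    · rw [← h0, Real.zero_rpow (by linarith), zero_mul]; exact Real.rpow_nonneg (hV x) _
    · rw [Real.div_rpow (hV x) (by positivity), ← Real.rpow_mul (hg x),
        mul_div_cancel₀ _ two_ne_zero, mul_div_cancel₀ _ (by positivity)]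
  simp only [h2, inv_div] at h1
  refine h1.trans ?_
  rw [mul_comm]
  gcongr
  · exact Real.rpow_nonneg (Finset.expect_nonneg fun x _ => Real.rpow_nonneg (hg x) q) _
  calc (𝔼 x, g x ^ q * (V x / g x ^ (2 : ℝ)) ^ (q / 2)) ^ (2 / q)
      ≤ (c ^ (q / 2)) ^ (2 / q) := by
        refine Real.rpow_le_rpow (Finset.expect_nonneg fun x _ => ?_)
          ((Finset.expect_le_expect fun x _ => h3 x).trans h) (by positivity)
        have := hg x; have := hV x; positivity
    _ = c := by
        rw [← Real.rpow_mul hc, div_mul_div_cancel₀ two_ne_zero, div_self (by linarith),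
          Real.rpow_one]

/-- Minkowski's inequality with one constant function. -/
lemma expect_const_add_rpow_le {ι : Type*} [Fintype ι] [Nonempty ι] {a M q : ℝ}
    (hq : 1 ≤ q) (ha : 0 ≤ a) (hM : 0 < M) {f : ι → ℝ} (hf : ∀ x, 0 ≤ f x) (h : 𝔼 x, f x ^ q ≤ M ^ q) : 𝔼 x, (a + f x) ^ q ≤ (a + M) ^ q := by
  have haM : 0 < a + M := by linarith
  have key : ∀ x, (a + f x) ^ q ≤
      (a + M) ^ q * (a / (a + M) + M / (a + M) * (f x ^ q / M ^ q)) := fun x => by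
    have h1 := (convexOn_rpow hq).2 (Set.mem_Ici.2 zero_le_one)
      (Set.mem_Ici.2 (div_nonneg (hf x) hM.le)) (by positivity : 0 ≤ a / (a + M))
      (by positivity : 0 ≤ M / (a + M)) (by field_simp)
    simp only [smul_eq_mul, Real.one_rpow, mul_one, Real.div_rpow (hf x) hM.le] at h1
    have h2 : a + f x = (a + M) * (a / (a + M) + M / (a + M) * (f x / M)) := by
      field_simp
    have h3 : 0 ≤ a / (a + M) + M / (a + M) * (f x / M) := by
      have := hf x; positivity
    rw [h2, Real.mul_rpow haM.le h3]
    gcongr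
  refine (Finset.expect_le_expect fun x _ => key x).trans ?_
  rw [← Finset.mul_expect, Finset.expect_add_distrib, ← Finset.mul_expect, Fintype.expect_const,
    ← Finset.expect_div]
  have h4 : (𝔼 x, f x ^ q) / M ^ q ≤ 1 := (div_le_one (by positivity)).2 h
  calc (a + M) ^ q * (a / (a + M) + M / (a + M) * ((𝔼 x, f x ^ q) / M ^ q))
      ≤ (a + M) ^ q * (a / (a + M) + M / (a + M) * 1) := by gcongr
    _ = (a + M) ^ q := by field_simp

/-! ### Solving the moment recursion -/

lemma kappa_bounds : 1 < 2 * kappa ∧ (2 * kappa)⁻¹ = 1 - Real.exp (-(1 / 2)) := by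
  have hs : √(Real.exp 1) = Real.exp (1 / 2) := by
    rw [Real.sqrt_eq_rpow, ← Real.exp_mul, one_mul]
  have h1 : 1 < Real.exp (1 / 2) := Real.one_lt_exp_iff.2 (by norm_num)
  have h2 : 2 * kappa = Real.exp (1 / 2) / (Real.exp (1 / 2) - 1) := by
    have : Real.exp (1 / 2) - 1 ≠ 0 := by linarith
    rw [kappa, hs]; field_simp
  constructor
  · rw [h2, one_lt_div (by linarith)]; linarith
  · rw [h2, inv_div, Real.exp_neg, sub_div, div_self (by positivity), one_div]

/-- If `Y` exceeded the bound, the second term would be at most `Y / (2κ)` and the first less than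
`e^(-1/2) * Y`, as `(1 - 1/q)^(q/2) ≤ e^(-1/2)`. These two fractions of `Y` add up to `Y` by the
choice of `kappa`. -/
lemma rpow_bound_step {q c Y : ℝ} (hq : 2 < q) (hc : 0 < c)
    (h : Y ≤ ((2 * kappa * (q - 1) * c) ^ ((q - 1) / 2)) ^ (q / (q - 1)) +
      q * (c * Y ^ (1 - 2 / q))) : Y ≤ (2 * kappa * q * c) ^ (q / 2) := by
  obtain ⟨hK, hKe⟩ := kappa_bounds
  set K := 2 * kappa with hKdef
  by_contra! hY
  have hq0 : 0 < q := by linarith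
  have hB : 0 < K * q * c := by positivity
  have hq1 : 0 < q - 1 := by linarith
  have hY0 : 0 < Y := (Real.rpow_pos_of_pos hB _).trans hY
  have h1 : K * q * c < Y ^ (2 / q) := by
    have := Real.rpow_lt_rpow (by positivity) hY (z := 2 / q) (by positivity)
    rwa [← Real.rpow_mul hB.le, div_mul_div_cancel₀ two_ne_zero, div_self hq0.ne',
      Real.rpow_one] at this
  have h2 : q * (c * Y ^ (1 - 2 / q)) ≤ K⁻¹ * Y := by
    rw [Real.rpow_sub hY0, Real.rpow_one]
    have hpos : 0 < Y ^ (2 / q) := by positivity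
    rw [← mul_assoc, mul_div_assoc', div_le_iff₀ hpos]
    have : K⁻¹ * Y * (K * q * c) ≤ K⁻¹ * Y * Y ^ (2 / q) := by gcongr
    calc q * c * Y = K⁻¹ * Y * (K * q * c) := by field_simp
      _ ≤ _ := this
  have h3 : ((K * (q - 1) * c) ^ ((q - 1) / 2)) ^ (q / (q - 1)) =
      ((q - 1) / q) ^ (q / 2) * (K * q * c) ^ (q / 2) := by
    rw [← Real.rpow_mul (by positivity), ← Real.mul_rpow (by positivity) (by positivity)]
    congr 1 <;> field_simp
  have h4 : ((q - 1) / q) ^ (q / 2) ≤ Real.exp (-(1 / 2)) := by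
    have : (q - 1) / q ≤ Real.exp (-(1 / q)) := by
      have := Real.add_one_le_exp (-(1 / q))
      calc (q - 1) / q = -(1 / q) + 1 := by field_simp; ring
        _ ≤ _ := this
    calc ((q - 1) / q) ^ (q / 2) ≤ Real.exp (-(1 / q)) ^ (q / 2) := by gcongr
      _ = Real.exp (-(1 / 2)) := by rw [← Real.exp_mul]; congr 1; field_simp
  rw [h3] at h
  have h5 : Real.exp (-(1 / 2)) = 1 - K⁻¹ := by rw [hKe]; ring
  rw [h5] at h4
  have h6 : ((q - 1) / q) ^ (q / 2) * (K * q * c) ^ (q / 2) < (1 - K⁻¹) * Y := by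
    have : 0 < 1 - K⁻¹ := by rw [← h5]; positivity
    calc _ ≤ (1 - K⁻¹) * (K * q * c) ^ (q / 2) := by gcongr
      _ < _ := by gcongr
  linarith

lemma expect_posPart_sq_le {n : ℕ} {f : (Fin n → ℤˣ) → ℝ} (hf : ∀ x, 0 ≤ f x) :
    𝔼 x, max (f x - 𝔼 y, f y) 0 ^ 2 ≤ 𝔼 x, upVariation f x := by
  refine le_trans ?_ (expect_sq_sub_sq_expect_le hf)
  have h1 : 𝔼 x, f x ^ 2 - (𝔼 x, f x) ^ 2 = 𝔼 x, (f x - 𝔼 y, f y) ^ 2 := by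
    simp only [sub_sq, Finset.expect_add_distrib, Finset.expect_sub_distrib, Fintype.expect_const]
    rw [← Finset.expect_mul, ← Finset.mul_expect]
    ring
  rw [h1]
  refine Finset.expect_le_expect fun x _ => ?_
  rcases le_total (f x - 𝔼 y, f y) 0 with h | h
  · rw [max_eq_right h, zero_pow two_ne_zero]; positivity
  · rw [max_eq_left h]

/-- The moment inequality for the positive part of a nonnegative function on the cube. -/
theorem expect_posPart_rpow_le_of_upVariation {n : ℕ} {q Q c : ℝ} (hq : 1 ≤ q) (hqQ : q ≤ Q)
    (hQ : 2 ≤ Q) (hc : 0 < c) {f : (Fin n → ℤˣ) → ℝ} (hf : ∀ x, 0 ≤ f x)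
    (hV : 𝔼 x, upVariation f x ^ (Q / 2) ≤ c ^ (Q / 2)) :
    𝔼 x, max (f x - 𝔼 y, f y) 0 ^ q ≤ (2 * kappa * q * c) ^ (q / 2) := by
  have hV0 := upVariation_nonneg f
  have hg0 : ∀ x, 0 ≤ max (f x - 𝔼 y, f y) 0 := fun x => le_max_right _ _
  have hK := kappa_bounds.1
  -- Induction lowers the real exponent `q` by one until it lies in `[1, 2]`, where the Efron-Stein
  -- inequality applies; `Q` stays fixed, so the hypothesis on the variation is unchanged.
  obtain ⟨k, hk⟩ := exists_nat_ge q
  induction k generalizing q with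
  | zero => norm_num at hk; linarith
  | succ k ih =>
    rcases le_or_gt q 2 with h2 | h2
    · have h3 : 𝔼 x, max (f x - 𝔼 y, f y) 0 ^ (2 : ℝ) ≤ (√c) ^ (2 : ℝ) := by
        simp only [Real.rpow_two, Real.sq_sqrt hc.le]
        refine (expect_posPart_sq_le hf).trans ?_
        simpa using expect_rpow_le_of_le one_pos (by linarith) hc.le hV0 hV
      refine (expect_rpow_le_of_le (by linarith) h2 (by positivity) hg0 h3).trans ?_
      rw [Real.sqrt_eq_rpow, ← Real.rpow_mul hc.le, one_div_mul_eq_div]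
      gcongr
      nlinarith [mul_le_mul hK.le hq zero_le_one (by linarith)]
    · refine rpow_bound_step h2 hc ((expect_posPart_rpow_le h2.le f _).trans ?_)
      have h3 := ih (q := q - 1) (by linarith) (by linarith) (by push_cast at hk; linarith)
      have h4 := expect_mul_rpow_le h2 hc.le hV0 hg0
        (expect_rpow_le_of_le (by positivity) (by linarith) hc.le hV0 hV)
      have h5 : 0 ≤ 𝔼 x, max (f x - 𝔼 y, f y) 0 ^ (q - 1) :=
        Finset.expect_nonneg fun x _ => Real.rpow_nonneg (hg0 x) _
      gcongr

/-- The moment inequality with `c = 2 * M ^ 2`. The exponent is at least `2` because the starting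
estimate concerns second moments; for `q ≤ 2` that estimate suffices, as `2 * kappa * q ≥ 1`. -/
lemma expect_posPart_rpow_le_of_upVariation_le_sq {n : ℕ} {q M : ℝ} (hq : 1 ≤ q) (hM : 0 < M)
    {f g : (Fin n → ℤˣ) → ℝ} (hf : ∀ x, 0 ≤ f x) (hg : ∀ x, 0 ≤ g x)
    (hfg : ∀ x, upVariation f x ≤ 2 * g x ^ 2)
    (h : 𝔼 x, g x ^ max q 2 ≤ M ^ max q 2) :
    𝔼 x, max (f x - 𝔼 y, f y) 0 ^ max q 2 ≤ (√(4 * kappa * q) * M) ^ max q 2 := by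
  have hK := kappa_bounds.1
  have hc : 0 < 2 * M ^ 2 := by positivity
  have e : ∀ (y : ℝ) (Q : ℝ), 0 ≤ y → (2 * y ^ 2) ^ (Q / 2) = 2 ^ (Q / 2) * y ^ Q := by
    intro y Q hy
    rw [Real.mul_rpow (by norm_num) (by positivity), ← Real.rpow_two, ← Real.rpow_mul hy,
      mul_div_cancel₀ _ two_ne_zero]
  have hV : 𝔼 x, upVariation f x ^ (max q 2 / 2) ≤ (2 * M ^ 2) ^ (max q 2 / 2) := by
    calc 𝔼 x, upVariation f x ^ (max q 2 / 2) ≤ 𝔼 x, (2 * g x ^ 2) ^ (max q 2 / 2) :=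
          Finset.expect_le_expect fun x _ =>
            Real.rpow_le_rpow (upVariation_nonneg f x) (hfg x) (by positivity)
      _ = 2 ^ (max q 2 / 2) * 𝔼 x, g x ^ max q 2 := by
          rw [Finset.mul_expect]; exact Finset.expect_congr rfl fun x _ => e _ _ (hg x)
      _ ≤ 2 ^ (max q 2 / 2) * M ^ max q 2 := by gcongr
      _ = _ := (e _ _ hM.le).symm
  have hsq : (√(4 * kappa * q) * M) ^ 2 = 2 * kappa * q * (2 * M ^ 2) := by
    rw [mul_pow, Real.sq_sqrt (by nlinarith)]; ring
  rcases le_total q 2 with h2 | h2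
  · rw [max_eq_right h2] at *
    simp only [Real.rpow_two]
    rw [hsq]
    refine (expect_posPart_sq_le hf).trans ?_
    have h3 : 𝔼 x, upVariation f x ≤ 2 * M ^ 2 := by simpa using hV
    have : 1 ≤ 2 * kappa * q := by nlinarith
    nlinarith
  · rw [max_eq_left h2] at *
    refine (expect_posPart_rpow_le_of_upVariation hq le_rfl h2 hc hf hV).trans_eq ?_
    rw [← hsq, ← Real.rpow_two, ← Real.rpow_mul (by positivity), mul_div_cancel₀ _ two_ne_zero]

/-! ### Iteration along the chain and the tail bound -/

/-- The moment inequality for a chain of functions on the cube, each of which controls the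
variation of the one before. -/
theorem expect_posPart_rpow_le_of_chain {n d : ℕ} (hd : 1 ≤ d) {q B : ℝ} (hq : 1 ≤ q)
    {W : ℕ → (Fin n → ℤˣ) → ℝ} (hW : ∀ k x, 0 ≤ W k x)
    (hvar : ∀ k < d, ∀ x, upVariation (W k) x ≤ 2 * W (k + 1) x ^ 2)
    (hconst : ∀ x y, W d x = W d y) (hpos : ∀ j ∈ Finset.Icc 1 d, 0 < 𝔼 x, W j x)
    (hB : ∀ j ∈ Finset.Icc 1 d, √(4 * kappa * q) ^ j * 𝔼 x, W j x ≤ B) :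
    𝔼 x, max (W 0 x - 𝔼 y, W 0 y) 0 ^ max q 2 ≤ (d * B) ^ max q 2 := by
  set r : ℝ := √(4 * kappa * q) with hr
  have hr0 : 0 < r := Real.sqrt_pos.2 (by have := kappa_bounds.1; nlinarith)
  -- Here `M` is `∑_{d - m ≤ j ≤ d} r ^ (j - (d - m)) * E W_j`, built by `‖W k‖ ≤ E W k + r * ‖W (k
  -- + 1)‖`; after multiplication by `r ^ (d - m)` each of its `m + 1` terms is at most `B`.
  have key : ∀ m, m < d → ∃ M, 0 < M ∧ 𝔼 x, W (d - m) x ^ max q 2 ≤ M ^ max q 2 ∧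
      r ^ (d - m) * M ≤ (m + 1) * B := by
    intro m
    induction m with
    | zero =>
      intro _
      have hd' : d ∈ Finset.Icc 1 d := Finset.mem_Icc.2 ⟨hd, le_rfl⟩
      refine ⟨𝔼 x, W d x, hpos d hd', ?_, by simpa using hB d hd'⟩
      simp only [Nat.sub_zero, fun x => hconst x 1, Fintype.expect_const, le_refl]
    | succ m ih =>
      intro hm
      obtain ⟨M, hM, h1, h2⟩ := ih (by omega)
      obtain ⟨k, hk⟩ : ∃ k, k = d - (m + 1) := ⟨_, rfl⟩
      have hk1 : d - m = k + 1 := by omega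
      have hkm : k ∈ Finset.Icc 1 d := Finset.mem_Icc.2 ⟨by omega, by omega⟩
      rw [hk1] at h1 h2
      rw [← hk]
      have h3 := expect_posPart_rpow_le_of_upVariation_le_sq hq hM (hW k) (hW (k + 1))
        (hvar k (by omega)) h1
      refine ⟨𝔼 x, W k x + r * M, add_pos (hpos k hkm) (by positivity), ?_, ?_⟩
      · refine le_trans (Finset.expect_le_expect fun x _ => ?_)
          (expect_const_add_rpow_le (a := 𝔼 y, W k y) (one_le_two.trans (le_max_right q 2))
            (hpos k hkm).le (by positivity) (fun x => le_max_right (W k x - 𝔼 y, W k y) 0) h3)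
        refine Real.rpow_le_rpow (hW k x) ?_ (by positivity)
        linarith [le_max_left (W k x - 𝔼 y, W k y) 0]
      · have := hB k hkm
        push_cast
        rw [pow_succ] at h2
        linarith
  obtain ⟨M, hM, h1, h2⟩ := key (d - 1) (by omega)
  rw [Nat.sub_sub_self hd] at h1 h2
  refine (expect_posPart_rpow_le_of_upVariation_le_sq hq hM (hW 0) (hW 1)
    (hvar 0 (by omega)) h1).trans ?_
  rw [Nat.cast_sub hd, pow_one] at h2
  push_cast at h2
  rw [sub_add_cancel] at h2
  exact Real.rpow_le_rpow (by positivity) h2 (by positivity)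

/-- The tail inequality for a chain of functions on the cube. -/
theorem expect_tail_le_of_chain {n d : ℕ} (hd : 1 ≤ d) {t : ℝ} (ht : 0 ≤ t)
    {W : ℕ → (Fin n → ℤˣ) → ℝ} (hW : ∀ k x, 0 ≤ W k x)
    (hvar : ∀ k < d, ∀ x, upVariation (W k) x ≤ 2 * W (k + 1) x ^ 2)
    (hconst : ∀ x y, W d x = W d y) {P : ℝ} (hP : P ≤ 1)
    (hmarkov : ∀ Q : ℝ, 0 < Q → t ^ Q * P ≤ 𝔼 x, max (W 0 x - 𝔼 y, W 0 y) 0 ^ Q) :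
    P ≤ 2 * Real.exp (-(Real.log 2 / (4 * kappa)) *
      (Finset.Icc 1 d).inf' (Finset.nonempty_Icc.mpr hd)
        (fun j => (t / (2 * d * 𝔼 x, W j x)) ^ (2 / (j : ℝ)))) := by
  have hK := kappa_bounds.1
  set m := (Finset.Icc 1 d).inf' (Finset.nonempty_Icc.mpr hd)
    (fun j => (t / (2 * d * 𝔼 x, W j x)) ^ (2 / (j : ℝ))) with hm
  have hd0 : (0 : ℝ) < d := by exact_mod_cast hd
  have hE : ∀ j, 0 ≤ 𝔼 x, W j x := fun j => Finset.expect_nonneg fun x _ => hW j x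
  -- With this `q`, `√(4κq) ^ j * E W_j ≤ t / (2d)` for every `j`, so the chain bound becomes `t /
  -- 2`.
  set q := m / (4 * kappa) with hqdef
  have hexp : Real.exp (-(Real.log 2 / (4 * kappa)) * m) = (1 / 2) ^ q := by
    rw [one_div, Real.inv_rpow (by norm_num), ← Real.rpow_neg (by norm_num),
      Real.rpow_def_of_pos (by norm_num), hqdef]
    congr 1; ring
  rw [hexp]
  -- For `q < 1` the right-hand side exceeds `1`. This covers a vanishing `E W_j`, since division by
  -- zero then makes the minimum `0`.
  rcases lt_or_ge q 1 with hq | hq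
  · have : (1 / 2 : ℝ) ≤ (1 / 2) ^ q := by
      simpa using Real.rpow_le_rpow_of_exponent_ge (x := 1 / 2) (by norm_num) (by norm_num) hq.le
    linarith
  have hmq : 4 * kappa * q = m := mul_div_cancel₀ _ (by linarith)
  have hmpos : 0 < m := by rw [← hmq]; nlinarith
  have hmj : ∀ j ∈ Finset.Icc 1 d, m ≤ (t / (2 * d * 𝔼 x, W j x)) ^ (2 / (j : ℝ)) :=
    fun j hj => Finset.inf'_le _ hj
  have hdiv : ∀ j ∈ Finset.Icc 1 d, 0 < t / (2 * d * 𝔼 x, W j x) := fun j hj => by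
    have hj0 : (0 : ℝ) < j := by exact_mod_cast (Finset.mem_Icc.1 hj).1
    refine lt_of_le_of_ne (div_nonneg ht (mul_nonneg (by positivity) (hE j))) fun h => ?_
    have := hmj j hj
    rw [← h, Real.zero_rpow (by positivity)] at this
    linarith
  have hpos : ∀ j ∈ Finset.Icc 1 d, 0 < 𝔼 x, W j x := fun j hj => by
    refine lt_of_le_of_ne (hE j) fun h => ?_
    have := hdiv j hj
    rw [← h] at this
    simp at this
  have ht0 : 0 < t := lt_of_le_of_ne ht fun h => by
    have := hdiv 1 (Finset.mem_Icc.2 ⟨le_rfl, hd⟩)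
    rw [← h] at this
    simp at this
  have hB : ∀ j ∈ Finset.Icc 1 d, √(4 * kappa * q) ^ j * 𝔼 x, W j x ≤ t / (2 * d) := by
    intro j hj
    have hj0 : (0 : ℝ) < j := by exact_mod_cast (Finset.mem_Icc.1 hj).1
    have h1 : √m ^ j ≤ t / (2 * d * 𝔼 x, W j x) := by
      rw [← Real.rpow_natCast, Real.sqrt_eq_rpow, ← Real.rpow_mul hmpos.le]
      calc m ^ (1 / 2 * (j : ℝ)) ≤ ((t / (2 * d * 𝔼 x, W j x)) ^ (2 / (j : ℝ))) ^ (1 / 2 * (j : ℝ)) :=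
            Real.rpow_le_rpow hmpos.le (hmj j hj) (by positivity)
        _ = t / (2 * d * 𝔼 x, W j x) := by
            rw [← Real.rpow_mul (hdiv j hj).le]
            have : 2 / (j : ℝ) * (1 / 2 * j) = 1 := by field_simp
            rw [this, Real.rpow_one]
    rw [hmq]
    have := hpos j hj
    calc √m ^ j * 𝔼 x, W j x ≤ t / (2 * d * 𝔼 x, W j x) * 𝔼 x, W j x := by gcongr
      _ = t / (2 * d) := by field_simp
  have h1 := (hmarkov (max q 2) (by positivity)).trans
    (expect_posPart_rpow_le_of_chain hd hq hW hvar hconst hpos hB)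
  have h2 : (d : ℝ) * (t / (2 * d)) = t * (1 / 2) := by field_simp
  rw [h2, Real.mul_rpow ht (by norm_num)] at h1
  have h3 : P ≤ (1 / 2) ^ max q 2 := le_of_mul_le_mul_left h1 (by positivity)
  have h4 : (1 / 2 : ℝ) ^ max q 2 ≤ (1 / 2) ^ q :=
    Real.rpow_le_rpow_of_exponent_ge (by norm_num) (by norm_num) (le_max_left q 2)
  have h5 : 0 ≤ (1 / 2 : ℝ) ^ q := by positivity
  linarith

/-! ### Contractions of the chaos and their discrete gradients -/

/-- The extension by zero of a family indexed by the subsets of size `d`. -/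
noncomputable def extend {n d : ℕ} (τ : Subsets n d → ℝ) (S : Finset (Fin n)) : ℝ :=
  if h : S.card = d then τ ⟨S, h⟩ else 0

lemma contraction_eq {n d k : ℕ} (τ : Subsets n d → ℝ) (α : Fin k → EuclideanSpace ℝ (Fin n))
    (J : Finset (Fin n)) :
    contraction τ α J =
      ∑ i : Fin k → Fin n, (∏ h, α h (i h)) * extend τ (Finset.univ.image i ∪ J) := by
  refine Finset.sum_congr rfl fun i _ => ?_
  rw [extend]
  split_ifs <;> simp

lemma contraction_cons {n d k : ℕ} (τ : Subsets n d → ℝ) (α : Fin k → EuclideanSpace ℝ (Fin n))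
    (a : EuclideanSpace ℝ (Fin n)) (J : Finset (Fin n)) :
    contraction τ (Fin.cons a α : Fin (k + 1) → EuclideanSpace ℝ (Fin n)) J =
      ∑ i, a i * contraction τ α (insert i J) := by
  rw [contraction_eq, ← (Fin.consEquiv fun _ => Fin n).sum_comp, Fintype.sum_prod_type]
  refine Finset.sum_congr rfl fun i _ => ?_
  rw [contraction_eq, Finset.mul_sum]
  refine Finset.sum_congr rfl fun i' _ => ?_
  have h : Finset.univ.image (Fin.cons i i' : Fin (k + 1) → Fin n) ∪ J =
      Finset.univ.image i' ∪ insert i J := by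
    ext y
    simp [Fin.exists_fin_succ]
    tauto
  change (∏ h, (Fin.cons a α : Fin (k + 1) → EuclideanSpace ℝ (Fin n)) h
    ((Fin.cons i i' : Fin (k + 1) → Fin n) h)) * extend τ (Finset.univ.image (Fin.cons i i') ∪ J) = _
  rw [Fin.prod_univ_succ, ← mul_assoc, h]
  simp only [Fin.cons_zero, Fin.cons_succ]

lemma contraction_eq_zero {n d k : ℕ} (τ : Subsets n d → ℝ)
    (α : Fin k → EuclideanSpace ℝ (Fin n)) {J : Finset (Fin n)} (hJ : J.card + k < d) :
    contraction τ α J = 0 := by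
  rw [contraction_eq]
  refine Finset.sum_eq_zero fun i _ => ?_
  have h1 := Finset.card_union_le (Finset.univ.image i) J
  have h2 := (Finset.card_image_le (s := Finset.univ) (f := i)).trans_eq (Finset.card_fin k)
  rw [extend, dif_neg (by omega), mul_zero]

/-- The chaos of order `d - k` whose coefficients are the contractions of `τ` by `k` vectors. -/
noncomputable def contractedChaos {n d k : ℕ} (τ : Subsets n d → ℝ)
    (α : Fin k → EuclideanSpace ℝ (Fin n)) (x : Fin n → ℝ) : ℝ :=
  ∑ J : Subsets n (d - k), (∏ j ∈ J.1, x j) * contraction τ α J.1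

lemma contractedChaos_eq {n d k : ℕ} (τ : Subsets n d → ℝ)
    (α : Fin k → EuclideanSpace ℝ (Fin n)) (x : Fin n → ℝ) :
    contractedChaos τ α x =
      ∑ J ∈ Finset.powersetCard (d - k) Finset.univ, (∏ j ∈ J, x j) * contraction τ α J :=
  (Finset.sum_subtype (p := fun J => J.card = d - k) _
    (fun J => by rw [Finset.mem_powersetCard_univ])
    fun J => (∏ j ∈ J, x j) * contraction τ α J).symm

/-- The derivative of `contractedChaos τ α` in the `i`-th coordinate. -/
noncomputable def partialChaos {n d k : ℕ} (τ : Subsets n d → ℝ)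
    (α : Fin k → EuclideanSpace ℝ (Fin n)) (x : Fin n → ℝ) (i : Fin n) : ℝ :=
  ∑ J ∈ (Finset.powersetCard (d - (k + 1)) Finset.univ).filter (i ∉ ·),
    (∏ j ∈ J, x j) * contraction τ α (insert i J)

lemma contractedChaos_cons {n d k : ℕ} (hk : k < d) (τ : Subsets n d → ℝ)
    (α : Fin k → EuclideanSpace ℝ (Fin n)) (a : EuclideanSpace ℝ (Fin n)) (x : Fin n → ℝ) :
    contractedChaos τ (Fin.cons a α : Fin (k + 1) → EuclideanSpace ℝ (Fin n)) x =
      ∑ i, a i * partialChaos τ α x i := by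
  rw [contractedChaos_eq]
  simp only [contraction_cons, Finset.mul_sum, partialChaos]
  rw [Finset.sum_comm]
  refine Finset.sum_congr rfl fun i _ => ?_
  rw [Finset.sum_filter]
  refine Finset.sum_congr rfl fun J hJ => ?_
  -- If `i ∈ J`, then `insert i J = J` has only `d - k - 1` elements, and `k` further indices cannot
  -- bring it to size `d`.
  split_ifs with hi
  · have := (Finset.mem_powersetCard.1 hJ).2
    rw [Finset.insert_eq_of_mem hi, contraction_eq_zero τ α (by omega)]
    simp
  · ring

/-- Multilinearity: the subsets containing `i` carry the factor `x i`, and erasing `i` from them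
yields the partial derivative. -/
lemma contractedChaos_split {n d k : ℕ} (hk : k < d) (τ : Subsets n d → ℝ)
    (α : Fin k → EuclideanSpace ℝ (Fin n)) (x : Fin n → ℝ) (i : Fin n) :
    contractedChaos τ α x = x i * partialChaos τ α x i +
      ∑ J ∈ (Finset.powersetCard (d - k) Finset.univ).filter (i ∉ ·),
        (∏ j ∈ J, x j) * contraction τ α J := by
  rw [contractedChaos_eq, ← Finset.sum_filter_add_sum_filter_not _ (i ∈ ·)]
  congr 1
  rw [partialChaos, Finset.mul_sum]
  refine Finset.sum_nbij' (fun J => J.erase i) (fun J => insert i J) ?_ ?_ ?_ ?_ ?_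
  · intro J hJ
    simp only [Finset.mem_filter, Finset.mem_powersetCard_univ] at hJ ⊢
    exact ⟨by rw [Finset.card_erase_of_mem hJ.2]; omega, Finset.notMem_erase i J⟩
  · intro J hJ
    simp only [Finset.mem_filter, Finset.mem_powersetCard_univ] at hJ ⊢
    exact ⟨by rw [Finset.card_insert_of_notMem hJ.2]; omega, Finset.mem_insert_self i J⟩
  · intro J hJ
    exact Finset.insert_erase (Finset.mem_filter.1 hJ).2
  · intro J hJ
    exact Finset.erase_insert (Finset.mem_filter.1 hJ).2
  · intro J hJ
    have hJ := (Finset.mem_filter.1 hJ).2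
    rw [Finset.insert_erase hJ, ← mul_assoc, Finset.mul_prod_erase J x hJ]

lemma contractedChaos_sub_neg {n d k : ℕ} (hk : k < d) (τ : Subsets n d → ℝ)
    (α : Fin k → EuclideanSpace ℝ (Fin n)) {x y : Fin n → ℝ} {i : Fin n}
    (hi : y i = -x i) (hne : ∀ j ≠ i, y j = x j) :
    contractedChaos τ α x - contractedChaos τ α y = 2 * x i * partialChaos τ α x i := by
  have hprod : ∀ J : Finset (Fin n), i ∉ J → ∏ j ∈ J, y j = ∏ j ∈ J, x j := fun J hJ =>
    Finset.prod_congr rfl fun j hj => hne j fun h => hJ (h ▸ hj)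
  have h1 : partialChaos τ α y i = partialChaos τ α x i :=
    Finset.sum_congr rfl fun J hJ => by rw [hprod J (Finset.mem_filter.1 hJ).2]
  have h2 : ∑ J ∈ (Finset.powersetCard (d - k) Finset.univ).filter (i ∉ ·),
      (∏ j ∈ J, y j) * contraction τ α J =
      ∑ J ∈ (Finset.powersetCard (d - k) Finset.univ).filter (i ∉ ·),
        (∏ j ∈ J, x j) * contraction τ α J :=
    Finset.sum_congr rfl fun J hJ => by rw [hprod J (Finset.mem_filter.1 hJ).2]
  rw [contractedChaos_split hk τ α x i, contractedChaos_split hk τ α y i, h1, h2, hi]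
  ring

lemma supContraction_eq {n d : ℕ} (T : Set (Subsets n d → ℝ)) (k : ℕ) (x : Fin n → ℝ) :
    supContraction T k x = sSup ((fun q : (Subsets n d → ℝ) × (Fin k → EuclideanSpace ℝ (Fin n)) =>
      |contractedChaos q.1 q.2 x|) '' T ×ˢ {α | ∀ h, ‖α h‖ ≤ 1}) := by
  rw [Set.image_prod (fun τ α => |contractedChaos τ α x|)]
  rfl

lemma isCompact_prod_unitBalls {n d : ℕ} {T : Set (Subsets n d → ℝ)} (hT : IsCompact T) (k : ℕ) :
    IsCompact (T ×ˢ {α : Fin k → EuclideanSpace ℝ (Fin n) | ∀ h, ‖α h‖ ≤ 1}) := by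
  refine hT.prod ?_
  have := isCompact_univ_pi fun _ : Fin k =>
    isCompact_closedBall (0 : EuclideanSpace ℝ (Fin n)) 1
  convert this using 1
  ext α
  simp

lemma continuous_contractedChaos {n d k : ℕ} (x : Fin n → ℝ) :
    Continuous fun q : (Subsets n d → ℝ) × (Fin k → EuclideanSpace ℝ (Fin n)) =>
      contractedChaos q.1 q.2 x := by
  have hE : ∀ S, Continuous fun q : (Subsets n d → ℝ) × (Fin k → EuclideanSpace ℝ (Fin n)) =>
      extend q.1 S := fun S => by
    unfold extend
    split_ifs <;> fun_prop
  simp only [contractedChaos, contraction_eq]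
  fun_prop

lemma abs_contractedChaos_le {n d k : ℕ} {T : Set (Subsets n d → ℝ)} (hT : IsCompact T)
    {τ : Subsets n d → ℝ} (hτ : τ ∈ T) {α : Fin k → EuclideanSpace ℝ (Fin n)}
    (hα : ∀ h, ‖α h‖ ≤ 1) (x : Fin n → ℝ) :
    |contractedChaos τ α x| ≤ supContraction T k x := by
  rw [supContraction_eq]
  exact le_csSup ((isCompact_prod_unitBalls hT k).image (continuous_contractedChaos x).abs).bddAbove
    ⟨(τ, α), ⟨hτ, hα⟩, rfl⟩

lemma exists_supContraction_eq {n d : ℕ} {T : Set (Subsets n d → ℝ)} (hT : IsCompact T)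
    (hTne : T.Nonempty) (k : ℕ) (x : Fin n → ℝ) :
    ∃ τ ∈ T, ∃ α : Fin k → EuclideanSpace ℝ (Fin n), (∀ h, ‖α h‖ ≤ 1) ∧
      supContraction T k x = |contractedChaos τ α x| := by
  have hne : (T ×ˢ {α : Fin k → EuclideanSpace ℝ (Fin n) | ∀ h, ‖α h‖ ≤ 1}).Nonempty :=
    hTne.prod ⟨0, fun h => by simp⟩
  obtain ⟨⟨τ, α⟩, ⟨hτ, hα⟩, h⟩ := ((isCompact_prod_unitBalls hT k).image
    (continuous_contractedChaos x).abs).sSup_mem (hne.image _)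
  exact ⟨τ, hτ, α, hα, (supContraction_eq T k x).trans h.symm⟩

lemma supContraction_nonneg {n d : ℕ} (T : Set (Subsets n d → ℝ)) (k : ℕ) (x : Fin n → ℝ) :
    0 ≤ supContraction T k x := by
  rw [supContraction_eq]
  exact Real.sSup_nonneg (by rintro _ ⟨_, _, rfl⟩; exact abs_nonneg _)

lemma supContraction_zero {n d : ℕ} (T : Set (Subsets n d → ℝ)) (x : Fin n → ℝ) :
    supContraction T 0 x = supChaos T x := by
  have h : ∀ (τ : Subsets n d → ℝ) (α : Fin 0 → EuclideanSpace ℝ (Fin n)),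
      contractedChaos τ α x = chaos τ x := fun τ α => by
    refine Finset.sum_congr rfl fun I _ => ?_
    have hI : I.1.card = d := I.2
    rw [contraction_eq, Fintype.sum_unique]
    simp [extend, hI]
  rw [supContraction_eq, supChaos]
  simp only [h]
  congr 1
  ext y
  constructor
  · rintro ⟨⟨τ, α⟩, ⟨hτ, _⟩, rfl⟩
    exact ⟨τ, hτ, rfl⟩
  · rintro ⟨τ, hτ, rfl⟩
    exact ⟨(τ, 0), ⟨hτ, fun h => h.elim0⟩, rfl⟩

lemma supContraction_self {n d : ℕ} (T : Set (Subsets n d → ℝ)) (x y : Fin n → ℝ) :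
    supContraction T d x = supContraction T d y := by
  have h : ∀ (τ : Subsets n d → ℝ) (α : Fin d → EuclideanSpace ℝ (Fin n)),
      contractedChaos τ α x = contractedChaos τ α y := fun τ α => by
    refine Finset.sum_congr rfl fun J _ => ?_
    have hJ : J.1 = ∅ := Finset.card_eq_zero.1 (J.2.trans (Nat.sub_self d))
    simp [hJ]
  simp only [supContraction_eq, h]

/-- Duality: the normalized gradient is an admissible additional vector in the supremum of order `k
+ 1`. -/
lemma norm_partialChaos_le {n d k : ℕ} (hk : k < d) {T : Set (Subsets n d → ℝ)} (hT : IsCompact T)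
    {τ : Subsets n d → ℝ} (hτ : τ ∈ T) {α : Fin k → EuclideanSpace ℝ (Fin n)}
    (hα : ∀ h, ‖α h‖ ≤ 1) (x : Fin n → ℝ) :
    ∑ i, partialChaos τ α x i ^ 2 ≤ supContraction T (k + 1) x ^ 2 := by
  set D : EuclideanSpace ℝ (Fin n) := WithLp.toLp 2 (partialChaos τ α x) with hD
  have hDi : ∀ i, D i = partialChaos τ α x i := fun i => rfl
  have hsum : ∑ i, partialChaos τ α x i ^ 2 = ‖D‖ ^ 2 := by
    rw [EuclideanSpace.real_norm_sq_eq]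
  rw [hsum]
  refine pow_le_pow_left₀ (norm_nonneg D) ?_ 2
  rcases eq_or_ne D 0 with h0 | h0
  · rw [h0, norm_zero]; exact supContraction_nonneg T _ x
  have hn : 0 < ‖D‖ := norm_pos_iff.2 h0
  have h1 : ∀ h, ‖(Fin.cons (‖D‖⁻¹ • D) α : Fin (k + 1) → EuclideanSpace ℝ (Fin n)) h‖ ≤ 1 := by
    intro h
    refine Fin.cases ?_ (fun h => ?_) h
    · rw [Fin.cons_zero, norm_smul, norm_inv, norm_norm, inv_mul_cancel₀ hn.ne']
    · simpa using hα h
  have h2 := abs_contractedChaos_le hT hτ h1 x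
  rw [contractedChaos_cons hk] at h2
  have h3 : ∑ i, (‖D‖⁻¹ • D) i * partialChaos τ α x i = ‖D‖ := by
    simp only [PiLp.smul_apply, smul_eq_mul, hDi, mul_assoc]
    rw [← Finset.mul_sum]
    simp only [← sq]
    rw [hsum, sq, inv_mul_cancel_left₀ hn.ne']
  rw [h3] at h2
  exact (le_abs_self _).trans h2

/-- The real point of a point of the cube. -/
def toReal {n : ℕ} (x : Fin n → ℤˣ) (i : Fin n) : ℝ := ((x i : ℤ) : ℝ)

lemma toReal_flip_self {n : ℕ} (x : Fin n → ℤˣ) (i : Fin n) :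
    toReal (flip i x) i = -toReal x i := by
  simp [toReal, flip]

lemma toReal_flip_of_ne {n : ℕ} (x : Fin n → ℤˣ) {i j : Fin n} (h : j ≠ i) :
    toReal (flip i x) j = toReal x j := by
  simp [toReal, flip, h]

lemma toReal_sq {n : ℕ} (x : Fin n → ℤˣ) (i : Fin n) : toReal x i ^ 2 = 1 := by
  rcases Int.units_eq_one_or (x i) with h | h <;> simp [toReal, h]

/-- A maximizer at `x` is only a competitor at the flipped points, so it bounds all positive
increments at once, each by `2 * |∂_i|`. The sum of squares is at most four times the squared
gradient norm, and `upVariation` halves it. -/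
lemma upVariation_supContraction_le {n d k : ℕ} (hk : k < d) {T : Set (Subsets n d → ℝ)}
    (hT : IsCompact T) (hTne : T.Nonempty) (x : Fin n → ℤˣ) :
    upVariation (fun y => supContraction T k (toReal y)) x ≤
      2 * supContraction T (k + 1) (toReal x) ^ 2 := by
  obtain ⟨τ, hτ, α, hα, h⟩ := exists_supContraction_eq hT hTne k (toReal x)
  have h1 : ∀ i, max (supContraction T k (toReal x) - supContraction T k (toReal (flip i x))) 0 ^ 2
      ≤ 4 * partialChaos τ α (toReal x) i ^ 2 := fun i => by
    have h2 := abs_contractedChaos_le hT hτ hα (toReal (flip i x))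
    have h3 := contractedChaos_sub_neg hk τ α (toReal_flip_self x i)
      (fun j hj => toReal_flip_of_ne x hj)
    have h4 : max (supContraction T k (toReal x) - supContraction T k (toReal (flip i x))) 0 ≤
        |2 * toReal x i * partialChaos τ α (toReal x) i| := by
      rw [← h3, h]
      refine max_le ?_ (abs_nonneg _)
      have := abs_sub_abs_le_abs_sub (contractedChaos τ α (toReal x))
        (contractedChaos τ α (toReal (flip i x)))
      linarith
    refine (pow_le_pow_left₀ (le_max_right _ _) h4 2).trans_eq ?_
    rw [sq_abs, mul_pow, mul_pow, toReal_sq]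
    ring
  rw [upVariation, div_le_iff₀ two_pos]
  refine (Finset.sum_le_sum fun i _ => h1 i).trans ?_
  rw [← Finset.mul_sum]
  linarith [norm_partialChaos_le hk hT hτ hα (toReal x)]

/-- If every contraction by `k` vectors vanishes on the cube, so do its increments, hence its
gradient. -/
lemma supContraction_succ_eq_zero {n d k : ℕ} (hk : k < d) {T : Set (Subsets n d → ℝ)}
    (hT : IsCompact T) (hTne : T.Nonempty)
    (h : ∀ x : Fin n → ℤˣ, supContraction T k (toReal x) = 0) (x : Fin n → ℤˣ) :
    supContraction T (k + 1) (toReal x) = 0 := by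
  obtain ⟨τ, hτ, α, hα, h1⟩ := exists_supContraction_eq hT hTne (k + 1) (toReal x)
  obtain ⟨a, β, rfl⟩ : ∃ a β, α = Fin.cons a β := ⟨α 0, Fin.tail α, (Fin.cons_self_tail α).symm⟩
  have hβ : ∀ i, ‖β i‖ ≤ 1 := fun i => by simpa using hα i.succ
  have h2 : ∀ y : Fin n → ℤˣ, contractedChaos τ β (toReal y) = 0 := fun y =>
    abs_nonpos_iff.1 ((abs_contractedChaos_le hT hτ hβ _).trans_eq (h y))
  have h3 : ∀ i, partialChaos τ β (toReal x) i = 0 := fun i => by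
    have h4 := contractedChaos_sub_neg hk τ β (toReal_flip_self x i)
      (fun j hj => toReal_flip_of_ne x hj)
    have h5 := toReal_sq x i
    rw [h2, h2, sub_self] at h4
    have : toReal x i ≠ 0 := fun h0 => by simp [h0] at h5
    simpa [this] using h4.symm
  rw [h1, contractedChaos_cons hk]
  simp [h3]

lemma eq_zero_of_supContraction_self_eq_zero {n d : ℕ} {T : Set (Subsets n d → ℝ)}
    (hT : IsCompact T) {x : Fin n → ℝ} (h : supContraction T d x = 0)
    {τ : Subsets n d → ℝ} (hτ : τ ∈ T) : τ = 0 := by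
  funext I
  -- Basis vectors along an enumeration of `I` select the single tuple `e`, so the full contraction
  -- equals `τ I`.
  set e : Fin d → Fin n := fun h => I.1.orderEmbOfFin I.2 h with he
  set α : Fin d → EuclideanSpace ℝ (Fin n) := fun h => EuclideanSpace.single (e h) 1 with hα
  have h1 := abs_contractedChaos_le hT hτ (α := α) (fun h => by simp [hα]) x
  rw [h] at h1
  have h2 := abs_nonpos_iff.1 h1
  have himg : Finset.univ.image e = I.1 := by
    simp [he]
  rw [contractedChaos_eq, Nat.sub_self, Finset.powersetCard_zero, Finset.sum_singleton,
    Finset.prod_empty, one_mul, contraction_eq, Finset.sum_eq_single e] at h2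
  · simpa [hα, himg, extend, I.2] using h2
  · intro i _ hi
    obtain ⟨j, hj⟩ := Function.ne_iff.1 hi
    rw [Finset.prod_eq_zero (Finset.mem_univ j), zero_mul]
    simp [hα, hj]
  · simp

lemma supChaos_eq_zero_of_supContraction_eq_zero {n d j : ℕ} (hj : j ≤ d)
    {T : Set (Subsets n d → ℝ)} (hT : IsCompact T) (hTne : T.Nonempty)
    (h : ∀ x : Fin n → ℤˣ, supContraction T j (toReal x) = 0) (x : Fin n → ℝ) :
    supChaos T x = 0 := by
  have key : ∀ k, j ≤ k → k ≤ d → ∀ x : Fin n → ℤˣ, supContraction T k (toReal x) = 0 := by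
    intro k hjk
    induction k, hjk using Nat.le_induction with
    | base => exact fun _ => h
    | succ k _ ih => exact fun hk => supContraction_succ_eq_zero hk hT hTne (ih (by omega))
  have h0 : ∀ τ ∈ T, τ = 0 := fun τ hτ =>
    eq_zero_of_supContraction_self_eq_zero hT (key d hj le_rfl 1) hτ
  have h1 : (fun τ => |chaos τ x|) '' T = {0} := by
    refine (hTne.image _).subset_singleton_iff.1 ?_
    rintro _ ⟨τ, hτ, rfl⟩
    simp [h0 τ hτ, chaos]
  rw [supChaos, h1, csSup_singleton]

/-! ### From the Rademacher law to the uniform law on the cube -/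

instance : IsFiniteMeasure rademacherLaw :=
  ⟨by simp [rademacherLaw, ENNReal.inv_lt_top]⟩

lemma pi_rademacherLaw (n : ℕ) :
    Measure.pi (fun _ : Fin n => rademacherLaw) =
      ∑ x : Fin n → ℤˣ, ((2⁻¹ : ℝ≥0∞) ^ n) • Measure.dirac (toReal x) := by
  refine Measure.pi_eq fun s hs => ?_
  have h1 : ∀ i, rademacherLaw (s i) =
      ∑ u : ℤˣ, 2⁻¹ * (s i).indicator (1 : ℝ → ℝ≥0∞) ((u : ℤ) : ℝ) := fun i => by
    rw [rademacherLaw, Measure.add_apply, Measure.smul_apply, Measure.smul_apply,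
      Measure.dirac_apply' _ (hs i), Measure.dirac_apply' _ (hs i)]
    simp
  simp only [h1]
  rw [Finset.prod_univ_sum, Fintype.piFinset_univ, Measure.finsetSum_apply]
  refine Finset.sum_congr rfl fun x _ => ?_
  rw [Measure.smul_apply, Measure.dirac_apply' _ (MeasurableSet.univ_pi hs),
    Finset.prod_mul_distrib, Finset.prod_const, Finset.card_fin, smul_eq_mul]
  congr 1
  by_cases h : toReal x ∈ Set.univ.pi s
  · rw [Set.indicator_of_mem h]
    exact (Finset.prod_eq_one fun i _ => Set.indicator_of_mem (h i (Set.mem_univ i)) _).symm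
  · rw [Set.indicator_of_notMem h]
    simp only [Set.mem_univ_pi, not_forall] at h
    obtain ⟨i, hi⟩ := h
    exact (Finset.prod_eq_zero (Finset.mem_univ i) (Set.indicator_of_notMem hi _)).symm

section Law

variable {Ω : Type*} [MeasurableSpace Ω] {μ : Measure Ω} [IsProbabilityMeasure μ] {n : ℕ}
  {X : Fin n → Ω → ℝ}

lemma map_rademacher (hlaw : ∀ i, HasLaw (X i) rademacherLaw μ) (hindep : iIndepFun X μ) :
    μ.map (fun ω i => X i ω) =
      ∑ x : Fin n → ℤˣ, ((2⁻¹ : ℝ≥0∞) ^ n) • Measure.dirac (toReal x) := by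
  rw [(iIndepFun_iff_map_fun_eq_pi_map fun i => (hlaw i).aemeasurable).1 hindep,
    ← pi_rademacherLaw]
  simp only [fun i => (hlaw i).map_eq]

/-- The joint law is a finite sum of point masses, so no measurability or boundedness of `F` is
needed. -/
lemma integrable_comp_rademacher (hlaw : ∀ i, HasLaw (X i) rademacherLaw μ)
    (hindep : iIndepFun X μ) (F : (Fin n → ℝ) → ℝ) :
    Integrable (fun ω => F fun i => X i ω) μ ∧
      ∫ ω, F (fun i => X i ω) ∂μ = 𝔼 x : Fin n → ℤˣ, F (toReal x) := by
  have hX : AEMeasurable (fun ω i => X i ω) μ :=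
    aemeasurable_pi_lambda _ fun i => (hlaw i).aemeasurable
  have hc : ((2⁻¹ : ℝ≥0∞) ^ n) ≠ ∞ := by simp
  have hd : ∀ x ∈ (Finset.univ : Finset (Fin n → ℤˣ)),
      Integrable F (((2⁻¹ : ℝ≥0∞) ^ n) • Measure.dirac (toReal x)) := fun x _ =>
    (integrable_dirac (by simp)).smul_measure hc
  have hint : Integrable F (μ.map fun ω i => X i ω) := by
    rw [map_rademacher hlaw hindep]
    exact integrable_finsetSum_measure.2 hd
  refine ⟨(integrable_map_measure hint.aestronglyMeasurable hX).1 hint, ?_⟩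
  rw [← integral_map hX hint.aestronglyMeasurable, map_rademacher hlaw hindep,
    integral_finsetSum_measure hd, Fintype.expect_eq_sum_div_card, Finset.sum_div]
  refine Finset.sum_congr rfl fun x _ => ?_
  rw [integral_smul_measure, integral_dirac]
  simp [div_eq_inv_mul]

lemma rpow_mul_measureReal_le (hlaw : ∀ i, HasLaw (X i) rademacherLaw μ)
    (hindep : iIndepFun X μ) (F : (Fin n → ℝ) → ℝ) (m : ℝ) {t Q : ℝ} (ht : 0 ≤ t) (hQ : 0 < Q) :
    t ^ Q * μ.real {ω | m + t ≤ F fun i => X i ω} ≤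
      𝔼 x : Fin n → ℤˣ, max (F (toReal x) - m) 0 ^ Q := by
  obtain ⟨h1, h2⟩ := integrable_comp_rademacher hlaw hindep fun y => max (F y - m) 0 ^ Q
  rw [← h2]
  refine le_trans ?_ (mul_meas_ge_le_integral_of_nonneg
    (ae_of_all _ fun ω => Real.rpow_nonneg (le_max_right _ _) Q) h1 (t ^ Q))
  refine mul_le_mul_of_nonneg_left (measureReal_mono fun ω hω => ?_) (by positivity)
  have hω : m + t ≤ F fun i => X i ω := hω
  exact Real.rpow_le_rpow ht (le_max_of_le_left (by linarith)) hQ.le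

end Law

end RademacherChaos

theorem corollary4 {Ω : Type*} [MeasurableSpace Ω] (μ : Measure Ω) [IsProbabilityMeasure μ]
    (n d : ℕ) (hd : 1 ≤ d) (hdn : d < n)
    (X : Fin n → Ω → ℝ) (hlaw : ∀ i, HasLaw (X i) RademacherChaos.rademacherLaw μ)
    (hindep : iIndepFun X μ)
    (T : Set (RademacherChaos.Subsets n d → ℝ)) (hT : IsCompact T) (hTne : T.Nonempty)
    (Z : Ω → ℝ) (hZ : ∀ ω, Z ω = RademacherChaos.supChaos T (fun i => X i ω))
    (W : ℕ → Ω → ℝ)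
    (hW : ∀ k ω, W k ω = RademacherChaos.supContraction T k (fun i => X i ω)) :
    -- the expectations in the bound are those of integrable variables
    Integrable Z μ ∧ (∀ j ∈ Finset.Icc 1 d, Integrable (W j) μ) ∧
    ∀ t : ℝ, 0 ≤ t →
      μ.real {ω | (∫ ω', Z ω' ∂μ) + t ≤ Z ω} ≤
        2 * Real.exp (-(Real.log 2 / (4 * RademacherChaos.kappa)) *
          (Finset.Icc 1 d).inf' (Finset.nonempty_Icc.mpr hd)
            (fun j => (t / (2 * d * ∫ ω', W j ω' ∂μ)) ^ (2 / (j : ℝ)))) ∧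
      -- the degenerate case, where the bound is to be read with `t / 0 = ∞`, hence is `0`
      ((∃ j ∈ Finset.Icc 1 d, ∫ ω', W j ω' ∂μ = 0) → 0 < t →
        μ.real {ω | (∫ ω', Z ω' ∂μ) + t ≤ Z ω} = 0) := by
  open RademacherChaos in
  open scoped BigOperators in
  obtain rfl : Z = fun ω => supChaos T (fun i => X i ω) := funext hZ
  obtain rfl : W = fun k ω => supContraction T k (fun i => X i ω) :=
    funext fun k => funext (hW k)
  have hWi := fun k => integrable_comp_rademacher hlaw hindep (supContraction T k)
  obtain ⟨hZi, hZe⟩ := integrable_comp_rademacher hlaw hindep (supChaos T)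
  refine ⟨hZi, fun j _ => (hWi j).1, fun t ht => ?_⟩
  simp only [hZe, fun k => (hWi k).2]
  refine ⟨?_, ?_⟩
  · refine expect_tail_le_of_chain (W := fun k x => supContraction T k (toReal x)) hd ht
      (fun k x => supContraction_nonneg T k _)
      (fun k hk x => upVariation_supContraction_le hk hT hTne x)
      (fun x y => supContraction_self T _ _) measureReal_le_one fun Q hQ => ?_
    simp only [supContraction_zero]
    exact rpow_mul_measureReal_le hlaw hindep (supChaos T) _ ht hQ
  · rintro ⟨j, hj, h⟩ ht
    -- A nonnegative function with zero mean vanishes on the whole cube; vanishing passes up to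
    -- order `d` and forces every `τ ∈ T` to be `0`.
    have h0 := (Finset.expect_eq_zero_iff_of_nonneg fun x _ =>
      supContraction_nonneg T j (toReal x)).1 h
    have hZ0 := supChaos_eq_zero_of_supContraction_eq_zero (Finset.mem_Icc.1 hj).2 hT hTne
      fun x => h0 x (Finset.mem_univ x)
    have : {ω | 𝔼 x : Fin n → ℤˣ, supChaos T (toReal x) + t ≤ supChaos T fun i => X i ω} = ∅ := by
      ext ω
      simp [hZ0, ht]
    rw [this, measureReal_empty]
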